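/- **Theorem (Landau's radius theorem).** For $A>1$ and $z\in\mathbb{C}\setminus\{0,1\}$ put $$A_1(z)=\log\frac{A(1+|z|^2)}{|z|^2},\qquad A_2(z)=\log\frac{2A(1+|z|^2)}{|z-1|^2},\qquad A_3(z)=\log\bigl(A(1+|z|^2)\bigr),$$ $$\lambda_A(z)=\frac{4(1+|z|^2)}{|z|^2\,|z-1|^2\,A_1(z)^2A_2(z)^2A_3(z)^2},$$ so that $ds=\sqrt{2\lambda_A(z)}\,|dz|$ is a conformal metric on $\mathbb{C}\setminus\{0,1\}$. There is an absolute constant $A>9$ such that the following holds. Let $r>0$ and let $f$ be holomorphic on the disc $\{|z|<r\}$, omitting the values $0$ and $1$, with $f'(0)\neq 0$. Then $$r\le C,\qquad C:=\frac{2}{|f'(0)|\,\sqrt{2\lambda_A(f(0))}}\in(0,\infty).$$ In particular, $r$ is bounded by a positive constant which depends only on $f(0)$ and $f'(0)$. -/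

import Mathlib

/-- The three logarithmic factors of the metric on `ℂ \ {0, 1}`, with parameter `A`; for `1 < A`
each of them is positive on `ℂ \ {0, 1}`. -/
noncomputable def logFactorZero (A : ℝ) (z : ℂ) : ℝ :=
  Real.log (A * (1 + ‖z‖ ^ 2) / ‖z‖ ^ 2)

noncomputable def logFactorOne (A : ℝ) (z : ℂ) : ℝ :=
  Real.log (2 * A * (1 + ‖z‖ ^ 2) / ‖z - 1‖ ^ 2)

noncomputable def logFactorInfty (A : ℝ) (z : ℂ) : ℝ :=
  Real.log (A * (1 + ‖z‖ ^ 2))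

/-- The coefficient `λ` of the Hermitian metric `ds² = 2 λ(z) |dz|²` on `ℂ \ {0, 1}`. -/
noncomputable def puncturedLambda (A : ℝ) (z : ℂ) : ℝ :=
  4 * (1 + ‖z‖ ^ 2) /
    (‖z‖ ^ 2 * ‖z - 1‖ ^ 2 *
      logFactorZero A z ^ 2 * logFactorOne A z ^ 2 * logFactorInfty A z ^ 2)

/-- The radius bound `2 / (|a₁| √(2 λ(a₀)))`, where `√(2 λ)` is the density of the metric
`ds = √(2 λ(z)) |dz|`. It is a function of `a₀ = f(0)` and `a₁ = f'(0)` only. -/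
noncomputable def landauConstant (A : ℝ) (a₀ a₁ : ℂ) : ℝ :=
  2 / (‖a₁‖ * √(2 * puncturedLambda A a₀))

/-! This is the Ahlfors–Schwarz method. The metric `2λ|dz|²` has curvature at most `-1`, that is
`∂∂̄ log λ ≥ λ` (`exists_hasWirtingerJet_logPuncturedLambda`). The `log |z - c|²` terms are
harmonic, and each logarithmic factor has the same `∂∂̄`, namely `(1 + |z|²)⁻²`. Taking its
logarithm adds a gradient term that dominates `λ` near the puncture, and large `log A` makes the
remaining error small.

On a closed disc of radius `R < r`, the function `λ(f)|f'|²(R² - |z|²)²` vanishes on the boundary,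
so its maximum is interior. There `∂∂̄` of its logarithm is nonpositive, so the maximum is at most
`2R²`. Comparison with the centre gives `λ(f(0))|f'(0)|²R² ≤ 2` (`puncturedLambda_mul_le`), and `R →
r` finishes.

Only pointwise second order expansions are used, never `C²` calculus. -/

open Filter Topology Asymptotics ComplexConjugate

/-! ### Calculus of second order expansions -/

/-- `F` has a second order expansion at `z`, with Wirtinger derivative `d = ∂F(z)` and
mixed second derivative `l = ∂∂̄F(z)`. -/
def HasWirtingerJet (F : ℂ → ℝ) (z d : ℂ) (l : ℝ) : Prop :=
  ∃ a : ℂ, (fun h : ℂ => F (z + h) - (F z + 2 * (d * h).re + (a * h ^ 2).re + l * ‖h‖ ^ 2))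
    =o[𝓝 0] (fun h : ℂ => ‖h‖ ^ 2)

namespace HasWirtingerJet

variable {F G : ℂ → ℝ} {z d e : ℂ} {l m : ℝ}

theorem const (c : ℝ) (z : ℂ) : HasWirtingerJet (fun _ => c) z 0 0 :=
  ⟨0, by simp⟩

theorem add (hF : HasWirtingerJet F z d l) (hG : HasWirtingerJet G z e m) :
    HasWirtingerJet (fun w => F w + G w) z (d + e) (l + m) := by
  obtain ⟨a, ha⟩ := hF
  obtain ⟨b, hb⟩ := hG
  refine ⟨a + b, (ha.add hb).congr_left fun h => ?_⟩
  simp only [add_mul, Complex.add_re]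
  ring

theorem const_mul (c : ℝ) (hF : HasWirtingerJet F z d l) :
    HasWirtingerJet (fun w => c * F w) z (c * d) (c * l) := by
  obtain ⟨a, ha⟩ := hF
  refine ⟨c * a, (ha.const_mul_left c).congr_left fun h => ?_⟩
  simp only [mul_assoc, Complex.re_ofReal_mul]
  ring

theorem sub (hF : HasWirtingerJet F z d l) (hG : HasWirtingerJet G z e m) :
    HasWirtingerJet (fun w => F w - G w) z (d - e) (l - m) := by
  have := hF.add (hG.const_mul (-1))
  simpa [sub_eq_add_neg] using this

theorem normSq_sub (c z : ℂ) :
    HasWirtingerJet (fun w => ‖w - c‖ ^ 2) z (conj (z - c)) 1 := by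
  refine ⟨0, (isLittleO_zero _ _).congr_left fun h => ?_⟩
  simp only [← Complex.normSq_eq_norm_sq, Complex.normSq_apply]
  simp
  ring

/-- Summing the expansion over `h, -h, ih, -ih` cancels the linear and the `h²` terms and leaves
only the mixed one. -/
theorem nonpos_of_eventually_le (hF : HasWirtingerJet F z d l)
    (hmax : ∀ᶠ h in 𝓝 (0 : ℂ), F (z + h) ≤ F z) : l ≤ 0 := by
  obtain ⟨a, ha⟩ := hF
  by_contra! hl
  have key : ∀ᶠ h in 𝓝 (0 : ℂ),
      2 * (d * h).re + (a * h ^ 2).re + l / 2 * ‖h‖ ^ 2 ≤ 0 := by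
    filter_upwards [hmax, ha.def (half_pos hl)] with h h₁ h₂
    rw [Real.norm_eq_abs, Real.norm_eq_abs, abs_of_nonneg (sq_nonneg ‖h‖)] at h₂
    have := neg_abs_le (F (z + h) - (F z + 2 * (d * h).re + (a * h ^ 2).re + l * ‖h‖ ^ 2))
    linarith
  have key' : ∀ c : ℂ, ∀ᶠ h in 𝓝 (0 : ℂ),
      2 * (d * (c * h)).re + (a * (c * h) ^ 2).re + l / 2 * ‖c * h‖ ^ 2 ≤ 0 := fun c => by
    have : Tendsto (fun h : ℂ => c * h) (𝓝 0) (𝓝 0) := by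
      have : Continuous fun h : ℂ => c * h := by fun_prop
      simpa using this.tendsto 0
    exact this.eventually key
  have all : ∀ᶠ h in 𝓝 (0 : ℂ), ‖h‖ ^ 2 ≤ 0 := by
    filter_upwards [key' 1, key' (-1), key' Complex.I, key' (-Complex.I)] with h h₁ h₂ h₃ h₄
    simp [mul_pow] at h₁ h₂ h₃ h₄
    have : l * ‖h‖ ^ 2 ≤ 0 := by linarith
    exact nonpos_of_mul_nonpos_right this hl
  obtain ⟨ε, hε, hb⟩ := Metric.eventually_nhds_iff.1 all
  have := hb (y := ((ε / 2 : ℝ) : ℂ)) (by simp [abs_of_pos hε, hε])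
  rw [Complex.norm_real, Real.norm_eq_abs, sq_abs] at this
  nlinarith

theorem isBigO_sub_linear (hF : HasWirtingerJet F z d l) :
    (fun h : ℂ => F (z + h) - F z - 2 * (d * h).re) =O[𝓝 0] (fun h : ℂ => ‖h‖ ^ 2) := by
  obtain ⟨a, ha⟩ := hF
  have h1 : (fun h : ℂ => (a * h ^ 2).re) =O[𝓝 0] (fun h : ℂ => ‖h‖ ^ 2) := by
    refine IsBigO.of_bound ‖a‖ (Eventually.of_forall fun h => ?_)
    have := Complex.abs_re_le_norm (a * h ^ 2)
    rwa [norm_mul, norm_pow, ← Real.norm_eq_abs, ← norm_norm h, ← norm_pow ‖h‖] at this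
  have h2 : (fun h : ℂ => l * ‖h‖ ^ 2) =O[𝓝 0] (fun h : ℂ => ‖h‖ ^ 2) :=
    (isBigO_refl _ _).const_mul_left l
  exact ((ha.isBigO.add h1).add h2).congr_left fun h => by ring

theorem isBigO_linear (d : ℂ) :
    (fun h : ℂ => 2 * (d * h).re) =O[𝓝 0] (fun h : ℂ => ‖h‖) := by
  refine IsBigO.of_bound (2 * ‖d‖) (Eventually.of_forall fun h => ?_)
  have := Complex.abs_re_le_norm (d * h)
  rw [norm_mul] at this
  simp only [norm_mul, Real.norm_eq_abs, abs_two, abs_norm]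
  linarith

theorem isLittleO_sq_norm :
    (fun h : ℂ => ‖h‖ ^ 2) =o[𝓝 0] (fun h : ℂ => ‖h‖) :=
  (isLittleO_pow_id one_lt_two).comp_tendsto tendsto_norm_zero

theorem isBigO_sub (hF : HasWirtingerJet F z d l) :
    (fun h : ℂ => F (z + h) - F z) =O[𝓝 0] (fun h : ℂ => ‖h‖) :=
  ((hF.isBigO_sub_linear.trans isLittleO_sq_norm.isBigO).add (isBigO_linear d)).congr_left
    fun h => by ring

/-- Composition with a real function which has a second order expansion. -/
theorem real_comp {φ : ℝ → ℝ} {p q : ℝ} (hF : HasWirtingerJet F z d l)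
    (hφ : (fun k : ℝ => φ (F z + k) - (φ (F z) + p * k + q / 2 * k ^ 2)) =o[𝓝 0]
      (fun k : ℝ => k ^ 2)) :
    HasWirtingerJet (fun w => φ (F w)) z (p * d) (p * l + q * ‖d‖ ^ 2) := by
  have hO := hF.isBigO_sub
  have hO2 := hF.isBigO_sub_linear
  obtain ⟨a, ha⟩ := hF
  have ht : Tendsto (fun h : ℂ => F (z + h) - F z) (𝓝 0) (𝓝 0) :=
    hO.trans_tendsto tendsto_norm_zero
  have h1 := (hφ.comp_tendsto ht).trans_isBigO (hO.pow 2)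
  -- A difference of squares: the squared increment may be replaced by the square of its linear
  -- part.
  have h2 : (fun h : ℂ => (F (z + h) - F z - 2 * (d * h).re) *
      (F (z + h) - F z + 2 * (d * h).re)) =o[𝓝 0] (fun h : ℂ => ‖h‖ ^ 2) := by
    have := (hO2.trans_isLittleO isLittleO_sq_norm).mul_isBigO (hO.add (isBigO_linear d))
    exact this.congr_right fun h => (sq _).symm
  refine ⟨p * a + q * d ^ 2, ((h1.add (ha.const_mul_left p)).add
    (h2.const_mul_left (q / 2))).congr_left fun h => ?_⟩
  -- Splits the square of the linear part into a mixed term and an `h²` term.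
  have e2 : ‖d‖ ^ 2 * ‖h‖ ^ 2 = 2 * (d * h).re ^ 2 - ((d * h) ^ 2).re := by
    rw [← mul_pow, ← norm_mul, ← Complex.normSq_eq_norm_sq, Complex.normSq_apply, sq (d * h),
      Complex.mul_re (d * h)]
    ring
  have e3 : ((q : ℂ) * d ^ 2 * h ^ 2).re = q * ((d * h) ^ 2).re := by
    rw [mul_assoc, Complex.re_ofReal_mul, mul_pow]
  simp only [Function.comp_apply, add_sub_cancel, add_mul, Complex.add_re, e3]
  simp only [mul_assoc, Complex.re_ofReal_mul]
  rw [e2]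
  ring

end HasWirtingerJet

theorem Real.log_second_order {x : ℝ} (hx : 0 < x) :
    (fun k : ℝ => Real.log (x + k) - (Real.log x + x⁻¹ * k + (-(x ^ 2)⁻¹) / 2 * k ^ 2))
      =o[𝓝 0] (fun k : ℝ => k ^ 2) := by
  have h3 : (fun k : ℝ => k ^ 3) =o[𝓝 0] (fun k : ℝ => k ^ 2) :=
    isLittleO_pow_pow (by norm_num)
  -- For `|k| < x / 2` the denominator `1 - |k / x|` of the Taylor remainder is at least `1 / 2`,
  -- whence the 2.
  refine IsBigO.trans_isLittleO (IsBigO.of_bound (2 / x ^ 3) ?_) h3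
  filter_upwards [Metric.ball_mem_nhds (0 : ℝ) (half_pos hx)] with k hk
  rw [mem_ball_zero_iff, Real.norm_eq_abs] at hk
  have hy : |-(k / x)| ≤ 1 / 2 := by
    rw [abs_neg, abs_div, abs_of_pos hx, div_le_iff₀ hx]; linarith
  have := Real.abs_log_sub_add_sum_range_le (x := -(k / x)) (by linarith) 2
  have hne : 1 + k / x ≠ 0 := by
    have := (abs_le.1 hy).2
    intro h
    linarith
  have e : Real.log (x + k) = Real.log x + Real.log (1 + k / x) := by
    rw [← Real.log_mul hx.ne' hne]
    congr 1
    field_simp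
  rw [e]
  have hb : |-(k / x)| ^ (2 + 1) / (1 - |-(k / x)|) ≤ 2 / x ^ 3 * ‖k ^ 3‖ := by
    rw [div_le_iff₀ (by linarith)]
    have e3 : |-(k / x)| ^ (2 + 1) = ‖k ^ 3‖ / x ^ 3 := by
      rw [abs_neg, abs_div, abs_of_pos hx, div_pow, norm_pow, Real.norm_eq_abs]
    rw [e3]
    have : 0 ≤ ‖k ^ 3‖ / x ^ 3 := by positivity
    calc ‖k ^ 3‖ / x ^ 3 = 2 * (‖k ^ 3‖ / x ^ 3) * (1 / 2) := by ring
      _ ≤ 2 * (‖k ^ 3‖ / x ^ 3) * (1 - |-(k / x)|) := by gcongr; linarith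
      _ = _ := by ring
  refine le_trans (le_of_eq ?_) (this.trans hb)
  rw [Real.norm_eq_abs]
  congr 1
  simp [Finset.sum_range_succ]
  field_simp
  ring

namespace HasWirtingerJet

variable {F : ℂ → ℝ} {z d : ℂ} {l : ℝ}

theorem log (hF : HasWirtingerJet F z d l) (hz : 0 < F z) :
    HasWirtingerJet (fun w => Real.log (F w)) z (((F z)⁻¹ : ℝ) * d)
      ((F z)⁻¹ * l + -(F z ^ 2)⁻¹ * ‖d‖ ^ 2) :=
  hF.real_comp (Real.log_second_order hz)

/-- Composition with a holomorphic function. -/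
theorem comp_analyticAt {f : ℂ → ℂ} (hF : HasWirtingerJet F (f z) d l) (hf : AnalyticAt ℂ f z) :
    HasWirtingerJet (fun w => F (f w)) z (d * deriv f z) (l * ‖deriv f z‖ ^ 2) := by
  obtain ⟨p, hp⟩ := hf
  obtain ⟨a, ha⟩ := hF
  set b := deriv f z with hb
  set c := p.coeff 2
  have hdf : HasDerivAt f b z := hp.differentiableAt.hasDerivAt
  have hO : (fun h : ℂ => f (z + h) - f z) =O[𝓝 0] (fun h : ℂ => ‖h‖) := by
    have h1 := hdf.isBigO_sub
    have ht : Tendsto (fun h : ℂ => z + h) (𝓝 0) (𝓝 z) := by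
      have : Continuous fun h : ℂ => z + h := by fun_prop
      simpa using this.tendsto 0
    simpa [Function.comp_def] using (h1.comp_tendsto ht).norm_right
  have h3 : (fun h : ℂ => f (z + h) - f z - b * h - c * h ^ 2) =o[𝓝 0]
      (fun h : ℂ => ‖h‖ ^ 2) := by
    have h1 := hp.isBigO_sub_partialSum_pow 3
    have h2 : (fun h : ℂ => ‖h‖ ^ 3) =o[𝓝 0] (fun h : ℂ => ‖h‖ ^ 2) :=
      (isLittleO_pow_pow (𝕜 := ℝ) (by norm_num : 2 < 3)).comp_tendsto tendsto_norm_zero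
    refine (h1.trans_isLittleO h2).congr_left fun h => ?_
    have hc1 : p.coeff 1 = b := hp.deriv.symm
    have hc0 : p.coeff 0 = f z := hp.coeff_zero _
    simp only [FormalMultilinearSeries.partialSum, Finset.sum_range_succ, Finset.sum_range_zero,
      FormalMultilinearSeries.apply_eq_pow_smul_coeff, smul_eq_mul, hc1, hc0]
    ring
  have h2 : (fun h : ℂ => f (z + h) - f z - b * h) =O[𝓝 0] (fun h : ℂ => ‖h‖ ^ 2) := by
    have h4 : (fun h : ℂ => c * h ^ 2) =O[𝓝 0] (fun h : ℂ => ‖h‖ ^ 2) :=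
      IsBigO.of_bound ‖c‖ (Eventually.of_forall fun h => by simp)
    exact (h3.isBigO.add h4).congr_left fun h => by ring
  have hlin : (fun h : ℂ => b * h) =O[𝓝 0] (fun h : ℂ => ‖h‖) :=
    IsBigO.of_bound ‖b‖ (Eventually.of_forall fun h => by simp)
  have ht : Tendsto (fun h : ℂ => f (z + h) - f z) (𝓝 0) (𝓝 0) :=
    hO.trans_tendsto tendsto_norm_zero
  have r1 := (ha.comp_tendsto ht).trans_isBigO (hO.norm_left.pow 2)
  have r2 : (fun h : ℂ => 2 * (d * (f (z + h) - f z - b * h - c * h ^ 2)).re) =o[𝓝 0]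
      (fun h : ℂ => ‖h‖ ^ 2) := by
    refine IsLittleO.const_mul_left ?_ 2
    refine IsBigO.trans_isLittleO (IsBigO.of_bound 1 (Eventually.of_forall fun h => ?_))
      (h3.const_mul_left d)
    simpa only [Real.norm_eq_abs, one_mul] using Complex.abs_re_le_norm (d * (f (z + h) - f z - b * h - c * h ^ 2))
  have r3 : (fun h : ℂ => (a * ((f (z + h) - f z - b * h) * (f (z + h) - f z + b * h))).re)
      =o[𝓝 0] (fun h : ℂ => ‖h‖ ^ 2) := by
    have := ((h2.trans_isLittleO isLittleO_sq_norm).mul_isBigO (hO.add hlin)).const_mul_left a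
    refine IsBigO.trans_isLittleO (IsBigO.of_bound 1 (Eventually.of_forall fun h => ?_))
      (this.congr_right fun h => (sq _).symm)
    simpa only [Real.norm_eq_abs, one_mul] using Complex.abs_re_le_norm
      (a * ((f (z + h) - f z - b * h) * (f (z + h) - f z + b * h)))
  have r4 : (fun h : ℂ => l * (‖f (z + h) - f z‖ ^ 2 - ‖b * h‖ ^ 2))
      =o[𝓝 0] (fun h : ℂ => ‖h‖ ^ 2) := by
    refine IsLittleO.const_mul_left ?_ l
    have := (h2.trans_isLittleO isLittleO_sq_norm).norm_left.mul_isBigO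
      (hO.norm_left.add hlin.norm_left)
    refine IsBigO.trans_isLittleO (IsBigO.of_bound 1 (Eventually.of_forall fun h => ?_))
      (this.congr_right fun h => (sq _).symm)
    have e : ‖f (z + h) - f z‖ ^ 2 - ‖b * h‖ ^ 2 =
      (‖f (z + h) - f z‖ - ‖b * h‖) * (‖f (z + h) - f z‖ + ‖b * h‖) := by ring
    rw [e, one_mul, norm_mul, norm_mul (‖f (z + h) - f z - b * h‖), norm_norm]
    gcongr
    exact abs_norm_sub_norm_le _ _
  -- The second Taylor coefficient `c` of `f` enters only the `h²` term, so the mixed term is just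
  -- scaled by `|f'|²`.
  refine ⟨2 * d * c + a * b ^ 2, (((r1.add r2).add r3).add r4).congr_left fun h => ?_⟩
  have e1 : d * (f (z + h) - f z - b * h - c * h ^ 2) =
    d * (f (z + h) - f z) - d * b * h - d * c * h ^ 2 := by ring
  have e2 : a * ((f (z + h) - f z - b * h) * (f (z + h) - f z + b * h)) =
    a * (f (z + h) - f z) ^ 2 - a * b ^ 2 * h ^ 2 := by ring
  have e3 : ((2 * d * c + a * b ^ 2) * h ^ 2).re =
      2 * (d * c * h ^ 2).re + (a * b ^ 2 * h ^ 2).re := by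
    have : (2 * d * c + a * b ^ 2) * h ^ 2 =
      ((2 : ℝ) : ℂ) * (d * c * h ^ 2) + a * b ^ 2 * h ^ 2 := by push_cast; ring
    rw [this, Complex.add_re, Complex.re_ofReal_mul]
  simp only [Function.comp_apply, add_sub_cancel, e1, e2, e3, Complex.sub_re, norm_mul]
  ring

end HasWirtingerJet

/-! ### Expansions of the building blocks -/

theorem hasWirtingerJet_log_normSq_sub {c z : ℂ} (h : z ≠ c) :
    HasWirtingerJet (fun w => Real.log (‖w - c‖ ^ 2)) z (z - c)⁻¹ 0 := by
  have h0 : z - c ≠ 0 := sub_ne_zero.2 h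
  have hn : 0 < ‖z - c‖ := norm_pos_iff.2 h0
  convert (HasWirtingerJet.normSq_sub c z).log (by positivity) using 1
  · rw [Complex.inv_def, Complex.normSq_eq_norm_sq, mul_comm]
  · rw [Complex.norm_conj]
    field_simp
    ring

theorem hasWirtingerJet_log_one_add_normSq (z : ℂ) :
    HasWirtingerJet (fun w => Real.log (1 + ‖w‖ ^ 2)) z (((1 + ‖z‖ ^ 2)⁻¹ : ℝ) * conj z)
      ((1 + ‖z‖ ^ 2) ^ 2)⁻¹ := by
  have h1 := (HasWirtingerJet.const 1 z).add (HasWirtingerJet.normSq_sub 0 z)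
  simp only [sub_zero, zero_add] at h1
  have hn : 0 < 1 + ‖z‖ ^ 2 := by positivity
  convert h1.log hn using 1
  rw [Complex.norm_conj]
  field_simp
  ring

/-- The comparison metric is the hyperbolic one of the disc; at a maximum only its mixed derivative
matters, so `d` stays unspecified. -/
theorem hasWirtingerJet_log_sub_normSq {R : ℝ} {z : ℂ} (h : ‖z‖ < R) :
    ∃ d, HasWirtingerJet (fun w => Real.log (R ^ 2 - ‖w‖ ^ 2)) z d
      (-(R ^ 2 / (R ^ 2 - ‖z‖ ^ 2) ^ 2)) := by
  have h1 := (HasWirtingerJet.const (R ^ 2) z).sub (HasWirtingerJet.normSq_sub 0 z)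
  simp only [sub_zero, zero_sub] at h1
  have hn : 0 < R ^ 2 - ‖z‖ ^ 2 := by nlinarith [norm_nonneg z]
  refine ⟨((R ^ 2 - ‖z‖ ^ 2)⁻¹ : ℝ) * -conj z, ?_⟩
  convert h1.log hn using 1
  rw [norm_neg, Complex.norm_conj]
  field_simp
  ring

/-! ### The metric and its logarithmic factors -/

/-- The logarithm of `puncturedLambda A`, away from the punctures and up to an additive constant,
with the logarithms expanded. -/
noncomputable def logPuncturedLambda (A : ℝ) (z : ℂ) : ℝ :=
  Real.log (1 + ‖z‖ ^ 2) - Real.log (‖z - 0‖ ^ 2) - Real.log (‖z - 1‖ ^ 2)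
    - 2 * Real.log (Real.log A + Real.log (1 + ‖z‖ ^ 2) - Real.log (‖z - 0‖ ^ 2))
    - 2 * Real.log (Real.log (2 * A) + Real.log (1 + ‖z‖ ^ 2) - Real.log (‖z - 1‖ ^ 2))
    - 2 * Real.log (Real.log A + Real.log (1 + ‖z‖ ^ 2))

section factors

variable {A : ℝ} {z : ℂ}

theorem logFactorZero_eq (hA : 0 < A) (h0 : z ≠ 0) :
    logFactorZero A z = Real.log A + Real.log (1 + ‖z‖ ^ 2) - Real.log (‖z - 0‖ ^ 2) := by
  have : 0 < ‖z‖ := norm_pos_iff.2 h0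
  rw [logFactorZero, Real.log_div (by positivity) (by positivity),
    Real.log_mul (by positivity) (by positivity), sub_zero]

theorem logFactorOne_eq (hA : 0 < A) (h1 : z ≠ 1) :
    logFactorOne A z = Real.log (2 * A) + Real.log (1 + ‖z‖ ^ 2) - Real.log (‖z - 1‖ ^ 2) := by
  have : 0 < ‖z - 1‖ := norm_pos_iff.2 (sub_ne_zero.2 h1)
  rw [logFactorOne, Real.log_div (by positivity) (by positivity),
    Real.log_mul (by positivity) (by positivity)]

theorem logFactorInfty_eq (hA : 0 < A) :
    logFactorInfty A z = Real.log A + Real.log (1 + ‖z‖ ^ 2) := by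
  rw [logFactorInfty, Real.log_mul (by positivity) (by positivity)]

theorem log_le_logFactorZero (hA : 0 < A) (h0 : z ≠ 0) : Real.log A ≤ logFactorZero A z := by
  have : 0 < ‖z‖ := norm_pos_iff.2 h0
  refine Real.log_le_log hA ?_
  rw [le_div_iff₀ (by positivity)]
  nlinarith

theorem normSq_sub_one (z : ℂ) : ‖z - 1‖ ^ 2 = 1 + ‖z‖ ^ 2 - 2 * z.re := by
  simp only [← Complex.normSq_eq_norm_sq, Complex.normSq_apply]
  simp
  ring

theorem normSq_add_one (z : ℂ) : ‖z + 1‖ ^ 2 = 1 + ‖z‖ ^ 2 + 2 * z.re := by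
  simp only [← Complex.normSq_eq_norm_sq, Complex.normSq_apply]
  simp
  ring

theorem log_le_logFactorOne (hA : 0 < A) (h1 : z ≠ 1) : Real.log A ≤ logFactorOne A z := by
  have : 0 < ‖z - 1‖ := norm_pos_iff.2 (sub_ne_zero.2 h1)
  refine Real.log_le_log hA ?_
  rw [le_div_iff₀ (by positivity)]
  -- The parallelogram law; this is why `logFactorOne` carries `2 * A`.
  have : ‖z - 1‖ ^ 2 ≤ 2 * (1 + ‖z‖ ^ 2) := by
    nlinarith [normSq_sub_one z, normSq_add_one z, sq_nonneg ‖z + 1‖]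
  nlinarith

theorem log_le_logFactorInfty (hA : 0 < A) : Real.log A ≤ logFactorInfty A z := by
  refine Real.log_le_log hA ?_
  nlinarith [sq_nonneg ‖z‖]

theorem puncturedLambda_eq (hA : 1 < A) (h0 : z ≠ 0) (h1 : z ≠ 1) :
    puncturedLambda A z = 4 * Real.exp (logPuncturedLambda A z) := by
  have hA0 : 0 < A := by linarith
  have hl := Real.log_pos hA
  have hz : 0 < ‖z‖ := norm_pos_iff.2 h0
  have hz1 : 0 < ‖z - 1‖ := norm_pos_iff.2 (sub_ne_zero.2 h1)
  have p1 := hl.trans_le (log_le_logFactorZero hA0 h0)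
  have p2 := hl.trans_le (log_le_logFactorOne hA0 h1)
  have p3 := hl.trans_le (log_le_logFactorInfty hA0 (z := z))
  have e : ∀ x : ℝ, 2 * Real.log x = Real.log (x ^ 2) := fun x => by simp
  rw [logPuncturedLambda, ← logFactorZero_eq hA0 h0, ← logFactorOne_eq hA0 h1,
    ← logFactorInfty_eq hA0, puncturedLambda, e, e, e]
  simp only [Real.exp_sub, sub_zero]
  rw [Real.exp_log (by positivity), Real.exp_log (by positivity), Real.exp_log (by positivity),
    Real.exp_log (by positivity), Real.exp_log (by positivity), Real.exp_log (by positivity)]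
  field_simp

theorem puncturedLambda_pos (hA : 1 < A) (h0 : z ≠ 0) (h1 : z ≠ 1) : 0 < puncturedLambda A z := by
  rw [puncturedLambda_eq hA h0 h1]
  positivity

end factors

/-! ### The curvature bound -/

/-- The right side equals `3 * ((1 + p²)³ - 2p(1 + p⁴))`, so the claim reduces to `3p(1 + p⁴) ≤ (1 +
p²)³`. -/
theorem one_add_sq_pow_three_le (p : ℝ) :
    (1 + p ^ 2) ^ 3 ≤ 3 * ((1 + p ^ 4) * (1 - p) ^ 2 + 2 * p ^ 2 * (1 + p ^ 2)) := by
  have h : 0 ≤ (1 + p ^ 2) ^ 3 - 3 * p * (1 + p ^ 4) := by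
    nlinarith [sq_nonneg (1 + p ^ 2 - 2 * p), sq_nonneg (1 - p), sq_nonneg (p * (1 - p)),
      sq_nonneg (p ^ 3 - 1), sq_nonneg (p ^ 3 - p), sq_nonneg (p ^ 2 - 1), sq_nonneg (p ^ 2 - p),
      sq_nonneg (p ^ 3 - p ^ 2), sq_nonneg (p ^ 3 - 3 / 2 * p ^ 2 + 3 / 2 * p - 1), sq_nonneg p]
  nlinarith

/-- The bound which compares the poles of the metric at the three punctures with the
contributions of the three logarithmic factors to its curvature. -/
theorem one_add_normSq_pow_three_le (z : ℂ) :
    (1 + ‖z‖ ^ 2) ^ 3 ≤ 3 * (‖z‖ ^ 2 * ‖z - 1‖ ^ 2 + ‖z - 1‖ ^ 2 + ‖z + 1‖ ^ 2 * ‖z‖ ^ 2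
      + ‖z‖ ^ 2 * (‖z‖ ^ 2 * ‖z - 1‖ ^ 2)) := by
  have h := one_add_sq_pow_three_le ‖z‖
  -- With `s = |z|²` and `t = |z - 1|²` the bracket is `(1 + s²)t + 2s(1 + s)`, increasing in `t`;
  -- this reduces to the radial case.
  have ht : (1 - ‖z‖) ^ 2 ≤ ‖z - 1‖ ^ 2 := by
    rw [normSq_sub_one]
    nlinarith [Complex.re_le_norm z]
  have hu : ‖z + 1‖ ^ 2 = 2 * (1 + ‖z‖ ^ 2) - ‖z - 1‖ ^ 2 := by
    rw [normSq_add_one, normSq_sub_one]; ring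
  rw [hu]
  have : (1 + ‖z‖ ^ 4) * (1 - ‖z‖) ^ 2 ≤ (1 + ‖z‖ ^ 4) * ‖z - 1‖ ^ 2 := by gcongr
  nlinarith

/-- After factoring out `(1 + s)⁻²`, `h` splits the left side into a constant term and one term per
puncture. Each puncture term is absorbed by its gradient term, as `12 / 144 ≤ 2`; the constant is at
most `1 / 12`, while `1 - 2(x⁻¹ + y⁻¹ + w⁻¹) ≥ 1 / 2`. -/
theorem curvature_estimate {s t u x y w : ℝ} (hs : 0 < s) (ht : 0 < t) (hu : 0 ≤ u)
    (hx : 12 ≤ x) (hy : 12 ≤ y) (hw : 12 ≤ w)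
    (h : (1 + s) ^ 3 ≤ 3 * (s * t + t + u * s + s * (s * t))) :
    4 * (1 + s) / (s * t * x ^ 2 * y ^ 2 * w ^ 2) ≤
      ((1 + s) ^ 2)⁻¹ * (1 - 2 * (x⁻¹ + y⁻¹ + w⁻¹)
        + 2 * ((s * x ^ 2)⁻¹ + u / (t * y ^ 2) + s / w ^ 2)) := by
  have inv_le : ∀ v : ℝ, 12 ≤ v → v⁻¹ ≤ 1 / 12 := fun v hv => by
    rw [one_div]; exact inv_anti₀ (by norm_num) hv
  set a := x⁻¹ with ha
  set b := y⁻¹ with hb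
  set c := w⁻¹ with hc
  have ha1 : a ≤ 1 / 12 := inv_le x hx
  have hb1 : b ≤ 1 / 12 := inv_le y hy
  have hc1 : c ≤ 1 / 12 := inv_le w hw
  have ha0 : 0 < a := inv_pos.2 (by linarith)
  have hb0 : 0 < b := inv_pos.2 (by linarith)
  have hc0 : 0 < c := inv_pos.2 (by linarith)
  have sq_le : ∀ v : ℝ, 0 < v → v ≤ 1 / 12 → v ^ 2 ≤ 1 / 144 := fun v h0 h1 => by nlinarith
  have ha2 := sq_le a ha0 ha1
  have hb2 := sq_le b hb0 hb1
  have hc2 := sq_le c hc0 hc1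
  have el : 4 * (1 + s) / (s * t * x ^ 2 * y ^ 2 * w ^ 2) =
      ((1 + s) ^ 2)⁻¹ * (4 * ((1 + s) ^ 3 / (s * t)) * (a ^ 2 * b ^ 2 * c ^ 2)) := by
    have : x ≠ 0 := by linarith
    have : y ≠ 0 := by linarith
    have : w ≠ 0 := by linarith
    rw [ha, hb, hc]
    field_simp
  have er : (s * x ^ 2)⁻¹ + u / (t * y ^ 2) + s / w ^ 2 =
      s⁻¹ * a ^ 2 + u / t * b ^ 2 + s * c ^ 2 := by
    rw [ha, hb, hc]
    field_simp
  rw [el, er]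
  gcongr
  have h' : (1 + s) ^ 3 / (s * t) ≤ 3 * (1 + s⁻¹ + u / t + s) := by
    rw [div_le_iff₀ (by positivity)]
    refine h.trans (le_of_eq ?_)
    field_simp
  have hut : 0 ≤ u / t := by positivity
  have hs' : 0 < s⁻¹ := by positivity
  have prod_le : ∀ v w : ℝ, 0 ≤ v → 0 ≤ w → v ≤ 1 / 144 → w ≤ 1 / 144 → v * w ≤ 1 / 144 :=
    fun v w h1 h2 h3 h4 => by nlinarith
  have q1 := prod_le _ _ (sq_nonneg b) (sq_nonneg c) hb2 hc2
  have q2 := prod_le _ _ (sq_nonneg a) (sq_nonneg c) ha2 hc2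
  have q3 := prod_le _ _ (sq_nonneg a) (sq_nonneg b) ha2 hb2
  have q0 := prod_le _ _ (by positivity) (sq_nonneg c) q3 hc2
  calc 4 * ((1 + s) ^ 3 / (s * t)) * (a ^ 2 * b ^ 2 * c ^ 2)
      ≤ 4 * (3 * (1 + s⁻¹ + u / t + s)) * (a ^ 2 * b ^ 2 * c ^ 2) := by gcongr
    _ = 12 * (a ^ 2 * b ^ 2 * c ^ 2) + 12 * (s⁻¹ * a ^ 2 * (b ^ 2 * c ^ 2)
        + u / t * b ^ 2 * (a ^ 2 * c ^ 2) + s * c ^ 2 * (a ^ 2 * b ^ 2)) := by ring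
    _ ≤ 12 * (1 / 144) + 12 * (s⁻¹ * a ^ 2 * (1 / 144)
        + u / t * b ^ 2 * (1 / 144) + s * c ^ 2 * (1 / 144)) := by gcongr
    _ ≤ 1 - 2 * (a + b + c) + 2 * (s⁻¹ * a ^ 2 + u / t * b ^ 2 + s * c ^ 2) := by
      have : 0 ≤ s⁻¹ * a ^ 2 + u / t * b ^ 2 + s * c ^ 2 := by positivity
      linarith

/-- The curvature bound: `∂∂̄ log λ ≥ λ` on `ℂ \ {0, 1}`. -/
theorem exists_hasWirtingerJet_logPuncturedLambda {A : ℝ} {z : ℂ} (hA : 1 < A)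
    (hA12 : 12 ≤ Real.log A) (h0 : z ≠ 0) (h1 : z ≠ 1) :
    ∃ d l, HasWirtingerJet (logPuncturedLambda A) z d l ∧ puncturedLambda A z ≤ l := by
  have hA0 : 0 < A := by linarith
  have hS := hasWirtingerJet_log_one_add_normSq z
  have hs := hasWirtingerJet_log_normSq_sub h0
  have ht := hasWirtingerJet_log_normSq_sub h1
  have hz : 0 < ‖z‖ := norm_pos_iff.2 h0
  have hz1 : 0 < ‖z - 1‖ := norm_pos_iff.2 (sub_ne_zero.2 h1)
  have hx := hA12.trans (log_le_logFactorZero hA0 h0)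
  have hy := hA12.trans (log_le_logFactorOne hA0 h1)
  have hw := hA12.trans (log_le_logFactorInfty hA0 (z := z))
  have hx' := hx
  have hy' := hy
  have hw' := hw
  rw [logFactorZero_eq hA0 h0] at hx'
  rw [logFactorOne_eq hA0 h1] at hy'
  rw [logFactorInfty_eq hA0] at hw'
  have j1 := (((HasWirtingerJet.const (Real.log A) z).add hS).sub hs).log (by linarith)
  have j2 := (((HasWirtingerJet.const (Real.log (2 * A)) z).add hS).sub ht).log (by linarith)
  have j3 := ((HasWirtingerJet.const (Real.log A) z).add hS).log (by linarith)
  refine ⟨_, _, ((((hS.sub hs).sub ht).sub (j1.const_mul 2)).sub (j2.const_mul 2)).sub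
    (j3.const_mul 2), ?_⟩
  rw [← logFactorZero_eq hA0 h0, ← logFactorOne_eq hA0 h1, ← logFactorInfty_eq hA0]
  have n0 : ((1 + ‖z‖ ^ 2 : ℝ) : ℂ) ≠ 0 := by
    rw [Complex.ofReal_ne_zero]; positivity
  have cz : conj z * z = ((‖z‖ ^ 2 : ℝ) : ℂ) := by
    rw [mul_comm, Complex.mul_conj, Complex.normSq_eq_norm_sq]
  have hsub : z - 1 ≠ 0 := sub_ne_zero.2 h1
  have d1 : ‖(0 + ((1 + ‖z‖ ^ 2)⁻¹ : ℝ) * conj z - (z - 0)⁻¹ : ℂ)‖ ^ 2 =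
      (‖z‖ ^ 2 * (1 + ‖z‖ ^ 2) ^ 2)⁻¹ := by
    have : (0 + ((1 + ‖z‖ ^ 2)⁻¹ : ℝ) * conj z - (z - 0)⁻¹ : ℂ) =
        -(z * ((1 + ‖z‖ ^ 2 : ℝ) : ℂ))⁻¹ := by
      rw [Complex.ofReal_inv, zero_add, sub_zero]
      field_simp
      rw [cz]
      push_cast
      ring
    rw [this, norm_neg, norm_inv, norm_mul, Complex.norm_real, Real.norm_eq_abs, inv_pow, mul_pow,
      sq_abs]
  -- The numerator `conj z * (z - 1) - (1 + |z|²)` collapses to `-conj (z + 1)`, the source of `|z +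
  -- 1|²`.
  have d2 : ‖(0 + ((1 + ‖z‖ ^ 2)⁻¹ : ℝ) * conj z - (z - 1)⁻¹ : ℂ)‖ ^ 2 =
      ‖z + 1‖ ^ 2 / (‖z - 1‖ ^ 2 * (1 + ‖z‖ ^ 2) ^ 2) := by
    have : (0 + ((1 + ‖z‖ ^ 2)⁻¹ : ℝ) * conj z - (z - 1)⁻¹ : ℂ) =
        -(conj (z + 1) / ((z - 1) * ((1 + ‖z‖ ^ 2 : ℝ) : ℂ))) := by
      rw [Complex.ofReal_inv, map_add, map_one]
      field_simp
      have : conj z * (z - 1) = ((‖z‖ ^ 2 : ℝ) : ℂ) - conj z := by rw [mul_sub, cz, mul_one]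
      linear_combination (norm := (push_cast; ring)) this
    rw [this, norm_neg, norm_div, norm_mul, Complex.norm_real, Real.norm_eq_abs, div_pow, mul_pow,
      sq_abs, Complex.norm_conj]
  have d3 : ‖(0 + ((1 + ‖z‖ ^ 2)⁻¹ : ℝ) * conj z : ℂ)‖ ^ 2 =
      ‖z‖ ^ 2 / (1 + ‖z‖ ^ 2) ^ 2 := by
    rw [zero_add, norm_mul, Complex.norm_real, Real.norm_eq_abs, mul_pow, sq_abs,
      Complex.norm_conj, inv_pow, inv_mul_eq_div]
  rw [d1, d2, d3, puncturedLambda]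
  refine (curvature_estimate (by positivity) (by positivity) (sq_nonneg ‖z + 1‖) hx hy hw
    (one_add_normSq_pow_three_le z)).trans (le_of_eq ?_)
  have : logFactorZero A z ≠ 0 := by linarith
  have : logFactorOne A z ≠ 0 := by linarith
  have : logFactorInfty A z ≠ 0 := by linarith
  field_simp
  ring

theorem continuousAt_puncturedLambda {A : ℝ} {z : ℂ} (hA : 1 < A) (h0 : z ≠ 0) (h1 : z ≠ 1) :
    ContinuousAt (puncturedLambda A) z := by
  have hA0 : 0 < A := by linarith
  have hl := Real.log_pos hA
  have hz : 0 < ‖z‖ := norm_pos_iff.2 h0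
  have hz1 : 0 < ‖z - 1‖ := norm_pos_iff.2 (sub_ne_zero.2 h1)
  have p1 := hl.trans_le (log_le_logFactorZero hA0 h0)
  have p2 := hl.trans_le (log_le_logFactorOne hA0 h1)
  have p3 := hl.trans_le (log_le_logFactorInfty hA0 (z := z))
  have c1 : ContinuousAt (logFactorZero A) z :=
    ContinuousAt.log (by fun_prop (disch := positivity)) (by positivity)
  have c2 : ContinuousAt (logFactorOne A) z :=
    ContinuousAt.log (by fun_prop (disch := positivity)) (by positivity)
  have c3 : ContinuousAt (logFactorInfty A) z :=
    ContinuousAt.log (by fun_prop) (by positivity)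
  unfold puncturedLambda
  exact ContinuousAt.div (by fun_prop) (by fun_prop) (by positivity)

/-! ### The maximum principle and Landau's theorem -/

/-- The Ahlfors–Schwarz lemma for the metric `√(2 λ(z)) |dz|`, at the centre of a disc. -/
theorem puncturedLambda_mul_le {A R : ℝ} {f : ℂ → ℂ} (hA : 1 < A) (hA12 : 12 ≤ Real.log A)
    (hR : 0 < R) (hf : AnalyticOnNhd ℂ f (Metric.closedBall 0 R))
    (h01 : ∀ z ∈ Metric.closedBall (0 : ℂ) R, f z ≠ 0 ∧ f z ≠ 1) (hd : deriv f 0 ≠ 0) :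
    puncturedLambda A (f 0) * ‖deriv f 0‖ ^ 2 * R ^ 2 ≤ 2 := by
  set v : ℂ → ℝ := fun z =>
    puncturedLambda A (f z) * ‖deriv f z‖ ^ 2 * (R ^ 2 - ‖z‖ ^ 2) ^ 2 with hv
  have hvc : ContinuousOn v (Metric.closedBall 0 R) := fun z hz => by
    have c1 : ContinuousAt (fun z => puncturedLambda A (f z)) z :=
      (continuousAt_puncturedLambda hA (h01 z hz).1 (h01 z hz).2).comp (hf z hz).continuousAt
    have c2 : ContinuousAt (deriv f) z := (hf z hz).deriv.continuousAt
    exact ContinuousAt.continuousWithinAt (by fun_prop)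
  have h0mem : (0 : ℂ) ∈ Metric.closedBall (0 : ℂ) R := Metric.mem_closedBall_self hR.le
  obtain ⟨z, hz, hmax⟩ := (isCompact_closedBall (0 : ℂ) R).exists_isMaxOn ⟨0, h0mem⟩ hvc
  have hv0 : 0 < v 0 := by
    have := puncturedLambda_pos hA (h01 0 h0mem).1 (h01 0 h0mem).2
    have := norm_pos_iff.2 hd
    simp only [hv, norm_zero]
    have : 0 < R ^ 2 - (0 : ℝ) ^ 2 := by nlinarith
    positivity
  have hle : v 0 ≤ v z := hmax h0mem
  have hvz : 0 < v z := hv0.trans_le hle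
  have hzR : ‖z‖ < R := by
    refine lt_of_le_of_ne (mem_closedBall_zero_iff.1 hz) fun h => ?_
    simp [hv, h] at hvz
  have hdz : deriv f z ≠ 0 := fun h => by simp [hv, h] at hvz
  obtain ⟨d, l, hj, hl⟩ := exists_hasWirtingerJet_logPuncturedLambda hA hA12 (h01 z hz).1
    (h01 z hz).2
  have j1 := hj.comp_analyticAt (hf z hz)
  -- `log |f'|²` is harmonic near the maximum, since `f'` does not vanish there.
  have j2 := (hasWirtingerJet_log_normSq_sub hdz).comp_analyticAt (hf z hz).deriv
  obtain ⟨e, j3⟩ := hasWirtingerJet_log_sub_normSq hzR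
  have j := (j1.add j2).add (j3.const_mul 2)
  have hpos : 0 < R ^ 2 - ‖z‖ ^ 2 := by nlinarith [norm_nonneg z]
  have hlog : ∀ w ∈ Metric.ball (0 : ℂ) R, deriv f w ≠ 0 →
      logPuncturedLambda A (f w) + Real.log (‖deriv f w - 0‖ ^ 2)
        + 2 * Real.log (R ^ 2 - ‖w‖ ^ 2) = Real.log (v w / 4) := fun w hw hdw => by
    have hw' := Metric.ball_subset_closedBall hw
    have hwR : ‖w‖ < R := mem_ball_zero_iff.1 hw
    have h1 : 0 < R ^ 2 - ‖w‖ ^ 2 := by nlinarith [norm_nonneg w]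
    have h2 : 0 < ‖deriv f w‖ := norm_pos_iff.2 hdw
    have e1 : v w / 4 = Real.exp (logPuncturedLambda A (f w)) * ‖deriv f w‖ ^ 2 *
        (R ^ 2 - ‖w‖ ^ 2) ^ 2 := by
      simp only [hv]
      rw [puncturedLambda_eq hA (h01 w hw').1 (h01 w hw').2]
      ring
    rw [e1, Real.log_mul (by positivity) (by positivity),
      Real.log_mul (by positivity) (by positivity), Real.log_exp, sub_zero,
      Real.log_pow (R ^ 2 - ‖w‖ ^ 2) 2]
    norm_num
  have hle0 := j.nonpos_of_eventually_le (by
    have ht : Tendsto (fun h : ℂ => z + h) (𝓝 0) (𝓝 z) := by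
      have : Continuous fun h : ℂ => z + h := by fun_prop
      simpa using this.tendsto 0
    have ev : ∀ᶠ w in 𝓝 z, w ∈ Metric.ball (0 : ℂ) R ∧ deriv f w ≠ 0 :=
      (Metric.isOpen_ball.eventually_mem (mem_ball_zero_iff.2 hzR)).and
        ((hf z hz).deriv.continuousAt.eventually_ne hdz)
    filter_upwards [ht.eventually ev] with h hh
    rw [hlog _ hh.1 hh.2, hlog _ (mem_ball_zero_iff.2 hzR) hdz]
    have hw' := Metric.ball_subset_closedBall hh.1
    have hwR : ‖z + h‖ < R := mem_ball_zero_iff.1 hh.1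
    have h1 : 0 < R ^ 2 - ‖z + h‖ ^ 2 := by nlinarith [norm_nonneg (z + h)]
    have h2 := norm_pos_iff.2 hh.2
    have h3 := puncturedLambda_pos hA (h01 _ hw').1 (h01 _ hw').2
    have h4 : v (z + h) ≤ v z := hmax hw'
    have h5 : 0 < v (z + h) := by simp only [hv]; positivity
    exact Real.log_le_log (by positivity) (by linarith))
  have hvz' : v z ≤ 2 * R ^ 2 := by
    have h1 : puncturedLambda A (f z) * ‖deriv f z‖ ^ 2 ≤
        2 * (R ^ 2 / (R ^ 2 - ‖z‖ ^ 2) ^ 2) := by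
      have : puncturedLambda A (f z) * ‖deriv f z‖ ^ 2 ≤ l * ‖deriv f z‖ ^ 2 := by gcongr
      linarith
    calc v z ≤ 2 * (R ^ 2 / (R ^ 2 - ‖z‖ ^ 2) ^ 2) * (R ^ 2 - ‖z‖ ^ 2) ^ 2 := by
          simp only [hv]; gcongr
      _ = 2 * R ^ 2 := by field_simp
  have h0 : puncturedLambda A (f 0) * ‖deriv f 0‖ ^ 2 * R ^ 2 * R ^ 2 ≤ 2 * R ^ 2 := by
    refine le_trans (le_of_eq ?_) (hle.trans hvz')
    simp only [hv, norm_zero]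
    ring
  exact le_of_mul_le_mul_right h0 (by positivity)

theorem mainTheorem8 :
    ∃ A : ℝ, 9 < A ∧
      ∀ (r : ℝ) (f : ℂ → ℂ), 0 < r →
        DifferentiableOn ℂ f (Metric.ball 0 r) →
        (∀ z ∈ Metric.ball (0 : ℂ) r, f z ≠ 0 ∧ f z ≠ 1) →
        deriv f 0 ≠ 0 →
        0 < landauConstant A (f 0) (deriv f 0) ∧ r ≤ landauConstant A (f 0) (deriv f 0) := by
  have hA9 : 9 < Real.exp 12 := by linarith [Real.add_one_le_exp 12]
  have hA : 1 < Real.exp 12 := by linarith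
  -- Chosen so that `log A = 12`, the bound on the factors needed by `curvature_estimate`.
  refine ⟨Real.exp 12, hA9, fun r f hr hf h01 hd => ?_⟩
  obtain ⟨h0, h1⟩ := h01 0 (Metric.mem_ball_self hr)
  have hl : 0 < 2 * puncturedLambda (Real.exp 12) (f 0) := by
    linarith [puncturedLambda_pos hA h0 h1]
  have hn := norm_pos_iff.2 hd
  have hq := Real.sqrt_pos.2 hl
  refine ⟨div_pos two_pos (mul_pos hn hq), le_of_forall_lt fun c hc => ?_⟩
  -- `f` need not extend to the boundary, so the estimate is applied on smaller closed discs; the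
  -- maximum with 0 keeps `R` positive.
  obtain ⟨R, hcR, hRr⟩ := exists_between (max_lt hc hr)
  have hR : 0 < R := (le_max_right _ _).trans_lt hcR
  have hsub : Metric.closedBall (0 : ℂ) R ⊆ Metric.ball 0 r := Metric.closedBall_subset_ball hRr
  have key := puncturedLambda_mul_le hA (Real.log_exp 12).ge hR
    ((hf.analyticOnNhd Metric.isOpen_ball).mono hsub) (fun z hz => h01 z (hsub hz)) hd
  refine ((le_max_left _ _).trans_lt hcR).trans_le ?_
  rw [landauConstant, le_div_iff₀ (by positivity)]
  refine abs_le_of_sq_le_sq' ?_ (by norm_num) |>.2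
  rw [mul_pow, mul_pow, Real.sq_sqrt hl.le]
  linarith
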